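/- Let $\alpha_1,\alpha_2\in\mathbb{C}$ and let $p_1,p_2\in\mathbb{C}[u]$ be nonzero polynomials. Let $\tilde{\mathcal{A}}$ be the associative unital $\mathbb{C}$-algebra with generators $H,X_1^+,X_1^-,X_2^+,X_2^-$ and defining relations, for $i\in\{1,2\}$, $$HX_i^{\pm}-X_i^{\pm}H=\pm\alpha_i X_i^{\pm},\qquad X_i^{\pm}X_i^{\mp}=p_i\big(H\mp\tfrac{\alpha_i}{2}\big),\qquad X_1^+X_2^-=X_2^-X_1^+,\qquad X_1^-X_2^+=X_2^+X_1^-.$$ Let $\mathcal{I}$ be the two-sided ideal of $\tilde{\mathcal{A}}$ consisting of all $a\in\tilde{\mathcal{A}}$ such that $f(H)\,a=0$ for some nonzero polynomial $f\in\mathbb{C}[u]$, and let $\mathcal{A}=\mathcal{A}_{\alpha_1,\alpha_2}(p_1,p_2)=\tilde{\mathcal{A}}/\mathcal{I}$ be the corresponding noncommutative Kleinian fiber product. Then the following statements are equivalent: (i) $\mathcal{A}\neq\{0\}$; (ii) $H$ is algebraically independent over $\mathbb{C}$ in $\tilde{\mathcal{A}}$, that is, $f(H)\neq 0$ in $\tilde{\mathcal{A}}$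 for every nonzero $f\in\mathbb{C}[u]$; (iii) $(p_1,p_2)$ is a solution of the Mazorchuk–Turowska equation $$p_1\big(u+\tfrac{\alpha_2}{2}\big)\,p_2\big(u+\tfrac{\alpha_1}{2}\big)=p_1\big(u-\tfrac{\alpha_2}{2}\big)\,p_2\big(u-\tfrac{\alpha_1}{2}\big)\quad\text{in }\mathbb{C}[u].$$ -/

import Mathlib

open Polynomial

namespace KleinianFiberProduct

/-- The five generators `H, X₁⁺, X₁⁻, X₂⁺, X₂⁻`. -/
inductive Gen : Type
  | H | X1p | X1m | X2p | X2m

/-- `g x` is the generator `x` of the free algebra, `s c` is the scalar `c`. -/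
abbrev g (x : Gen) : FreeAlgebra ℂ Gen := FreeAlgebra.ι ℂ x

abbrev s (c : ℂ) : FreeAlgebra ℂ Gen := algebraMap ℂ (FreeAlgebra ℂ Gen) c

/-- The ten defining relations. -/
inductive Rel (α₁ α₂ : ℂ) (p₁ p₂ : ℂ[X]) : FreeAlgebra ℂ Gen → FreeAlgebra ℂ Gen → Prop
  | H_X1p : Rel α₁ α₂ p₁ p₂ (g .H * g .X1p - g .X1p * g .H) (α₁ • g .X1p)
  | H_X1m : Rel α₁ α₂ p₁ p₂ (g .H * g .X1m - g .X1m * g .H) (-(α₁ • g .X1m))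
  | H_X2p : Rel α₁ α₂ p₁ p₂ (g .H * g .X2p - g .X2p * g .H) (α₂ • g .X2p)
  | H_X2m : Rel α₁ α₂ p₁ p₂ (g .H * g .X2m - g .X2m * g .H) (-(α₂ • g .X2m))
  | X1p_X1m : Rel α₁ α₂ p₁ p₂ (g .X1p * g .X1m) (aeval (g .H - s (α₁ / 2)) p₁)
  | X1m_X1p : Rel α₁ α₂ p₁ p₂ (g .X1m * g .X1p) (aeval (g .H + s (α₁ / 2)) p₁)
  | X2p_X2m : Rel α₁ α₂ p₁ p₂ (g .X2p * g .X2m) (aeval (g .H - s (α₂ / 2)) p₂)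
  | X2m_X2p : Rel α₁ α₂ p₁ p₂ (g .X2m * g .X2p) (aeval (g .H + s (α₂ / 2)) p₂)
  | X1p_X2m : Rel α₁ α₂ p₁ p₂ (g .X1p * g .X2m) (g .X2m * g .X1p)
  | X1m_X2p : Rel α₁ α₂ p₁ p₂ (g .X1m * g .X2p) (g .X2p * g .X1m)

/-- The unquotiented algebra `Ã`, presented by the generators and relations above. -/
def ATilde (α₁ α₂ : ℂ) (p₁ p₂ : ℂ[X]) : Type := RingQuot (Rel α₁ α₂ p₁ p₂)

noncomputable instance (α₁ α₂ : ℂ) (p₁ p₂ : ℂ[X]) : Ring (ATilde α₁ α₂ p₁ p₂) :=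
  inferInstanceAs (Ring (RingQuot (Rel α₁ α₂ p₁ p₂)))

noncomputable instance (α₁ α₂ : ℂ) (p₁ p₂ : ℂ[X]) : Algebra ℂ (ATilde α₁ α₂ p₁ p₂) :=
  inferInstanceAs (Algebra ℂ (RingQuot (Rel α₁ α₂ p₁ p₂)))

/-- The canonical projection from the free algebra onto `Ã`. -/
noncomputable def mk (α₁ α₂ : ℂ) (p₁ p₂ : ℂ[X]) : FreeAlgebra ℂ Gen →ₐ[ℂ] ATilde α₁ α₂ p₁ p₂ :=
  RingQuot.mkAlgHom ℂ (Rel α₁ α₂ p₁ p₂)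

/-- The image of a generator in `Ã`. -/
noncomputable def gen (α₁ α₂ : ℂ) (p₁ p₂ : ℂ[X]) (x : Gen) : ATilde α₁ α₂ p₁ p₂ :=
  mk α₁ α₂ p₁ p₂ (g x)

/-- The element `H` of `Ã`. -/
noncomputable abbrev H (α₁ α₂ : ℂ) (p₁ p₂ : ℂ[X]) : ATilde α₁ α₂ p₁ p₂ := gen α₁ α₂ p₁ p₂ .H

/-- `a` is killed by left multiplication by `f(H)` for some nonzero polynomial `f`. -/
def IsTorsion (α₁ α₂ : ℂ) (p₁ p₂ : ℂ[X]) (a : ATilde α₁ α₂ p₁ p₂) : Prop :=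
  ∃ f : ℂ[X], f ≠ 0 ∧ aeval (H α₁ α₂ p₁ p₂) f * a = 0

section Helpers

variable {α₁ α₂ : ℂ} {p₁ p₂ : ℂ[X]}

theorem mk_rel {a b : FreeAlgebra ℂ Gen} (h : Rel α₁ α₂ p₁ p₂ a b) :
    mk α₁ α₂ p₁ p₂ a = mk α₁ α₂ p₁ p₂ b :=
  RingQuot.mkAlgHom_rel ℂ h

theorem mk_surjective : Function.Surjective (mk α₁ α₂ p₁ p₂) :=
  RingQuot.mkAlgHom_surjective ℂ (Rel α₁ α₂ p₁ p₂)

theorem gen_weight (x : Gen) : ∃ c : ℂ,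
    H α₁ α₂ p₁ p₂ * gen α₁ α₂ p₁ p₂ x =
      gen α₁ α₂ p₁ p₂ x * (H α₁ α₂ p₁ p₂ + algebraMap ℂ _ c) := by
  have key : ∀ c : ℂ, H α₁ α₂ p₁ p₂ * gen α₁ α₂ p₁ p₂ x
      - gen α₁ α₂ p₁ p₂ x * H α₁ α₂ p₁ p₂ = c • gen α₁ α₂ p₁ p₂ x →
      H α₁ α₂ p₁ p₂ * gen α₁ α₂ p₁ p₂ x =
      gen α₁ α₂ p₁ p₂ x * (H α₁ α₂ p₁ p₂ + algebraMap ℂ _ c) := by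
    intro c h
    rw [mul_add, ← Algebra.commutes, ← Algebra.smul_def, ← h]
    abel
  cases x with
  | H => exact ⟨0, by simp⟩
  | X1p =>
    refine ⟨α₁, key _ ?_⟩
    simpa [gen] using mk_rel (Rel.H_X1p (α₁ := α₁) (α₂ := α₂) (p₁ := p₁) (p₂ := p₂))
  | X1m =>
    refine ⟨-α₁, key _ ?_⟩
    simpa [gen] using mk_rel (Rel.H_X1m (α₁ := α₁) (α₂ := α₂) (p₁ := p₁) (p₂ := p₂))
  | X2p =>
    refine ⟨α₂, key _ ?_⟩
    simpa [gen] using mk_rel (Rel.H_X2p (α₁ := α₁) (α₂ := α₂) (p₁ := p₁) (p₂ := p₂))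
  | X2m =>
    refine ⟨-α₂, key _ ?_⟩
    simpa [gen] using mk_rel (Rel.H_X2m (α₁ := α₁) (α₂ := α₂) (p₁ := p₁) (p₂ := p₂))

theorem aeval_mul_of_semiconj {A : Type*} [Ring A] [Algebra ℂ A] {h x k : A}
    (hx : h * x = x * k) (f : ℂ[X]) : aeval h f * x = x * aeval k f := by
  induction f using Polynomial.induction_on' with
  | add p q hp hq => simp [add_mul, mul_add, hp, hq]
  | monomial n a =>
    have hpow : h ^ n * x = x * k ^ n := by
      induction n with
      | zero => simp
      | succ n ih => rw [pow_succ, mul_assoc, hx, ← mul_assoc, ih, mul_assoc, ← pow_succ]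
    rw [aeval_monomial, aeval_monomial, mul_assoc, hpow, ← mul_assoc, Algebra.commutes, mul_assoc]

theorem IsTorsion.zero : IsTorsion α₁ α₂ p₁ p₂ 0 := ⟨1, one_ne_zero, by simp⟩

theorem IsTorsion.add {a b : ATilde α₁ α₂ p₁ p₂} (ha : IsTorsion α₁ α₂ p₁ p₂ a)
    (hb : IsTorsion α₁ α₂ p₁ p₂ b) : IsTorsion α₁ α₂ p₁ p₂ (a + b) := by
  obtain ⟨f, hf, hfa⟩ := ha
  obtain ⟨k, hk, hkb⟩ := hb
  refine ⟨f * k, mul_ne_zero hf hk, ?_⟩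
  have h1 : aeval (H α₁ α₂ p₁ p₂) (f * k) * a = 0 := by
    rw [mul_comm f k, map_mul, mul_assoc, hfa, mul_zero]
  have h2 : aeval (H α₁ α₂ p₁ p₂) (f * k) * b = 0 := by
    rw [map_mul, mul_assoc, hkb, mul_zero]
  rw [mul_add, h1, h2, add_zero]

theorem IsTorsion.neg {a : ATilde α₁ α₂ p₁ p₂} (ha : IsTorsion α₁ α₂ p₁ p₂ a) :
    IsTorsion α₁ α₂ p₁ p₂ (-a) := by
  obtain ⟨f, hf, hfa⟩ := ha
  exact ⟨f, hf, by rw [mul_neg, hfa, neg_zero]⟩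

theorem IsTorsion.mul_right {a : ATilde α₁ α₂ p₁ p₂} (ha : IsTorsion α₁ α₂ p₁ p₂ a)
    (b : ATilde α₁ α₂ p₁ p₂) : IsTorsion α₁ α₂ p₁ p₂ (a * b) := by
  obtain ⟨f, hf, hfa⟩ := ha
  exact ⟨f, hf, by rw [← mul_assoc, hfa, zero_mul]⟩

theorem IsTorsion.gen_mul (x : Gen) {a : ATilde α₁ α₂ p₁ p₂} (ha : IsTorsion α₁ α₂ p₁ p₂ a) :
    IsTorsion α₁ α₂ p₁ p₂ (gen α₁ α₂ p₁ p₂ x * a) := by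
  obtain ⟨f, hf, hfa⟩ := ha
  obtain ⟨c, hc⟩ := gen_weight (α₁ := α₁) (α₂ := α₂) (p₁ := p₁) (p₂ := p₂) x
  refine ⟨f.comp (X - C c), ?_, ?_⟩
  · intro h0
    apply hf
    have h1 := congrArg (fun q : ℂ[X] => q.comp (X + C c)) h0
    simpa [comp_assoc] using h1
  · rw [← mul_assoc, aeval_mul_of_semiconj hc, aeval_comp]
    simp [mul_assoc, hfa]

theorem IsTorsion.mul_left (b : ATilde α₁ α₂ p₁ p₂) {a : ATilde α₁ α₂ p₁ p₂}
    (ha : IsTorsion α₁ α₂ p₁ p₂ a) : IsTorsion α₁ α₂ p₁ p₂ (b * a) := by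
  obtain ⟨w, rfl⟩ := mk_surjective b
  induction w using FreeAlgebra.induction generalizing a with
  | grade0 r =>
    obtain ⟨f, hf, hfa⟩ := ha
    refine ⟨f, hf, ?_⟩
    rw [AlgHom.commutes, ← mul_assoc, ← Algebra.commutes, mul_assoc, hfa, mul_zero]
  | grade1 x => exact ha.gen_mul x
  | mul u v hu hv => rw [map_mul, mul_assoc]; exact hu (hv ha)
  | add u v hu hv => rw [map_add, add_mul]; exact (hu ha).add (hv ha)

end Helpers

/-- The two-sided ideal `I` of all `a ∈ Ã` with `f(H) * a = 0` for some nonzero polynomial `f`. -/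
noncomputable def torsionIdeal (α₁ α₂ : ℂ) (p₁ p₂ : ℂ[X]) : TwoSidedIdeal (ATilde α₁ α₂ p₁ p₂) :=
  TwoSidedIdeal.mk' {a | IsTorsion α₁ α₂ p₁ p₂ a} IsTorsion.zero IsTorsion.add IsTorsion.neg
    (fun {x _} hy => IsTorsion.mul_left x hy) (fun {_ y} hx => IsTorsion.mul_right hx y)

theorem mem_torsionIdeal {α₁ α₂ : ℂ} {p₁ p₂ : ℂ[X]} {a : ATilde α₁ α₂ p₁ p₂} :
    a ∈ torsionIdeal α₁ α₂ p₁ p₂ ↔ IsTorsion α₁ α₂ p₁ p₂ a :=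
  TwoSidedIdeal.mem_mk' _ _ _ _ _ _ _

/-- The noncommutative Kleinian fiber product `A = Ã / I`. -/
abbrev A (α₁ α₂ : ℂ) (p₁ p₂ : ℂ[X]) : Type := (torsionIdeal α₁ α₂ p₁ p₂).ringCon.Quotient

/-- The Mazorchuk–Turowska equation, an identity in `ℂ[u]` (with `u = X`). -/
def MTE (α₁ α₂ : ℂ) (p₁ p₂ : ℂ[X]) : Prop :=
  p₁.comp (X + C (α₂ / 2)) * p₂.comp (X + C (α₁ / 2)) =
    p₁.comp (X - C (α₂ / 2)) * p₂.comp (X - C (α₁ / 2))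

end KleinianFiberProduct

namespace KleinianFiberProduct

section Relations

variable {α₁ α₂ : ℂ} {p₁ p₂ : ℂ[X]}

/-! The quotient by `torsionIdeal` vanishes exactly when it contains 1, that is, when f(H) = 0 for
some nonzero f; this is (i) ⇔ (ii). The Mazorchuk–Turowska equation is the consistency condition for
the word X₂⁻X₁⁺X₁⁻X₂⁺. Contracting the inner pair, or first commuting both outer letters inwards,
gives two polynomials in H (`aeval_shifted_eq`); if H is transcendental they coincide, and a
translation of u turns this into the equation. Conversely, a solution makes ℂ[u] a module on which H
acts as multiplication by u (`polyRep`). Then f(H) sends 1 to f, so f(H) ≠ 0 for f ≠ 0. -/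

theorem not_isTorsion_one_iff :
    ¬ IsTorsion α₁ α₂ p₁ p₂ 1 ↔ Transcendental ℂ (H α₁ α₂ p₁ p₂) := by
  simp only [IsTorsion, mul_one, Transcendental, IsAlgebraic]

theorem nontrivial_A_iff :
    Nontrivial (A α₁ α₂ p₁ p₂) ↔ ¬ IsTorsion α₁ α₂ p₁ p₂ 1 := by
  rw [← mem_torsionIdeal, TwoSidedIdeal.mem_iff]
  constructor
  · intro _ h
    exact one_ne_zero ((RingCon.eq (torsionIdeal α₁ α₂ p₁ p₂).ringCon).2 h :
      (1 : A α₁ α₂ p₁ p₂) = 0)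
  · intro h
    exact ⟨⟨1, 0, fun e => h ((RingCon.eq (torsionIdeal α₁ α₂ p₁ p₂).ringCon).1 e)⟩⟩

/-- Evaluation at a translate of an element is evaluation of the translated polynomial. -/
theorem aeval_add_algebraMap {B : Type*} [Ring B] [Algebra ℂ B] (h : B) (c : ℂ) (f : ℂ[X]) :
    aeval (h + algebraMap ℂ B c) f = aeval h (f.comp (X + C c)) := by
  simp [aeval_comp]

theorem semiconj_of_commutator {B : Type*} [Ring B] [Algebra ℂ B] {h x : B} {c : ℂ}
    (hx : h * x - x * h = c • x) : h * x = x * (h + algebraMap ℂ B c) := by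
  rw [mul_add, ← Algebra.commutes, ← Algebra.smul_def, ← hx]
  abel

/-- Comparing the two evaluations of `X₂⁻ X₁⁺ X₁⁻ X₂⁺` gives a shifted form of the
Mazorchuk–Turowska equation, evaluated at `H`. -/
theorem aeval_shifted_eq :
    aeval (H α₁ α₂ p₁ p₂)
        (p₁.comp (X + C (α₂ - α₁ / 2)) * p₂.comp (X + C (α₂ / 2))) =
      aeval (H α₁ α₂ p₁ p₂)
        (p₁.comp (X + C (-(α₁ / 2))) * p₂.comp (X + C (α₂ / 2 - α₁))) := by
  have hX1m := mk_rel (Rel.H_X1m (α₁ := α₁) (α₂ := α₂) (p₁ := p₁) (p₂ := p₂))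
  have hX2m := mk_rel (Rel.H_X2m (α₁ := α₁) (α₂ := α₂) (p₁ := p₁) (p₂ := p₂))
  have h1 := mk_rel (Rel.X1p_X1m (α₁ := α₁) (α₂ := α₂) (p₁ := p₁) (p₂ := p₂))
  have h2 := mk_rel (Rel.X2m_X2p (α₁ := α₁) (α₂ := α₂) (p₁ := p₁) (p₂ := p₂))
  have c1 := mk_rel (Rel.X1p_X2m (α₁ := α₁) (α₂ := α₂) (p₁ := p₁) (p₂ := p₂))
  have c2 := mk_rel (Rel.X1m_X2p (α₁ := α₁) (α₂ := α₂) (p₁ := p₁) (p₂ := p₂))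
  simp only [map_mul, map_sub, map_add, map_neg, map_smul, ← aeval_algHom_apply,
    AlgHom.commutes] at hX1m hX2m h1 h2 c1 c2
  rw [sub_eq_add_neg, ← map_neg, aeval_add_algebraMap] at h1
  rw [aeval_add_algebraMap] at h2
  rw [← neg_smul] at hX1m hX2m
  have s1 := aeval_mul_of_semiconj (semiconj_of_commutator hX1m)
  have s2 := aeval_mul_of_semiconj (semiconj_of_commutator hX2m)
  simp only [aeval_add_algebraMap] at s1 s2
  -- Moving a polynomial in H rightwards past X₁⁻ or X₂⁻ shifts its argument by -α₁ or -α₂. The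
  -- argument of p₁ starts at H + α₂ - α₁/2 so that it becomes that of X₁⁺X₁⁻ after passing X₂⁻.
  have e1 := s1 (p₂.comp (X + C (α₂ / 2)))
  have e2 := s2 (p₁.comp (X + C (α₂ - α₁ / 2)))
  simp only [comp_assoc, add_comp, X_comp, C_comp, add_assoc, ← C_add] at e1 e2
  rw [show -α₁ + α₂ / 2 = α₂ / 2 - α₁ by ring] at e1
  rw [show -α₂ + (α₂ - α₁ / 2) = -(α₁ / 2) by ring] at e2
  simp only [H, gen, map_mul]
  -- The left side unfolds to X₂⁻X₁⁺X₁⁻X₂⁺ and the right side to X₁⁺X₂⁻X₂⁺X₁⁻; the two mixed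
  -- commutations `c1` and `c2` identify them.
  rw [← h2, ← mul_assoc, e2, ← h1, mul_assoc, mul_assoc, c2, mul_assoc, ← e1, ← h2,
    mul_assoc, ← mul_assoc, ← c1]
  simp only [mul_assoc]

theorem MTE_of_transcendental (h : Transcendental ℂ (H α₁ α₂ p₁ p₂)) : MTE α₁ α₂ p₁ p₂ := by
  have h0 := transcendental_iff_injective.1 h (aeval_shifted_eq (p₁ := p₁) (p₂ := p₂))
  refine Polynomial.funext fun r => ?_
  -- This translation centres the arguments at r ± α₂/2 for p₁ and r ± α₁/2 for p₂.
  have h1 := congrArg (eval (r + (α₁ / 2 - α₂ / 2))) h0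
  simp only [eval_mul, eval_comp, eval_add, eval_sub, eval_X, eval_C] at h1 ⊢
  convert h1 using 3 <;> ring

end Relations

/-- The translation `f(u) ↦ f(u + c)` of polynomials. -/
noncomputable def translate (c : ℂ) : Module.End ℂ ℂ[X] := (aeval (X + C c)).toLinearMap

/-- The representation of the generators on `ℂ[u]` by multiplications and translations. -/
noncomputable def polyRepGen (α₁ α₂ : ℂ) (p₁ p₂ : ℂ[X]) : Gen → Module.End ℂ ℂ[X]
  | .H => Algebra.lmul ℂ ℂ[X] X
  | .X1p => translate (-α₁)
  | .X1m => translate α₁ * Algebra.lmul ℂ ℂ[X] (p₁.comp (X - C (α₁ / 2)))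
  | .X2p => Algebra.lmul ℂ ℂ[X] (p₂.comp (X - C (α₂ / 2))) * translate (-α₂)
  | .X2m => translate α₂

theorem translate_apply (c : ℂ) (f : ℂ[X]) : translate c f = f.comp (X + C c) := rfl

theorem aeval_lmul_add (f : ℂ[X]) (c : ℂ) :
    aeval (Algebra.lmul ℂ ℂ[X] X + algebraMap ℂ _ c) f
      = Algebra.lmul ℂ ℂ[X] (f.comp (X + C c)) := by
  rw [aeval_add_algebraMap, aeval_algHom_apply, aeval_X_left_apply]

theorem aeval_lmul_sub (f : ℂ[X]) (c : ℂ) :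
    aeval (Algebra.lmul ℂ ℂ[X] X - algebraMap ℂ _ c) f
      = Algebra.lmul ℂ ℂ[X] (f.comp (X - C c)) := by
  rw [sub_eq_add_neg, ← map_neg, aeval_lmul_add, C_neg, ← sub_eq_add_neg]

/-- Placing p₁ entirely in X₁⁻ and p₂ entirely in X₂⁺ leaves X₁⁺ and X₂⁻ as pure translations, which
commute. Only the commutation of X₁⁻ with X₂⁺ then requires the Mazorchuk–Turowska equation. -/
theorem polyRepGen_rel {α₁ α₂ : ℂ} {p₁ p₂ : ℂ[X]} (h : MTE α₁ α₂ p₁ p₂)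
    {a b : FreeAlgebra ℂ Gen} (hab : Rel α₁ α₂ p₁ p₂ a b) :
    FreeAlgebra.lift ℂ (polyRepGen α₁ α₂ p₁ p₂) a =
      FreeAlgebra.lift ℂ (polyRepGen α₁ α₂ p₁ p₂) b := by
  have h0 : ∀ r : ℂ, p₁.eval (r + α₁ / 2) * p₂.eval (r + α₁ - α₂ / 2) =
      p₁.eval (r - α₂ + α₁ / 2) * p₂.eval (r - α₂ / 2) := fun r => by
    have h1 := congrArg (eval (r + (α₁ / 2 - α₂ / 2))) h
    simp only [eval_mul, eval_comp, eval_add, eval_sub, eval_X, eval_C] at h1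
    linear_combination (norm := ring_nf) h1
  cases hab <;> refine LinearMap.ext fun f => Polynomial.funext fun r => ?_ <;>
    simp only [map_mul, map_sub, map_add, map_neg, map_smul, ← aeval_algHom_apply,
      AlgHom.commutes, FreeAlgebra.lift_ι_apply, polyRepGen, aeval_lmul_add, aeval_lmul_sub] <;>
    simp only [Module.End.mul_apply, LinearMap.sub_apply, LinearMap.neg_apply, LinearMap.smul_apply,
      translate_apply, Algebra.coe_lmul_eq_mul, LinearMap.mul_apply_apply, eval_mul, eval_comp,
      eval_add, eval_sub, eval_neg, eval_smul, eval_X, eval_C, smul_eq_mul]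
  -- Both orders translate f by α₁ - α₂; their polynomial coefficients are the two sides of `h0`.
  case X1m_X2p =>
    linear_combination (norm := ring_nf) f.eval (r + α₁ - α₂) * h0 r
  all_goals ring_nf

/-- The representation of `Ã` on `ℂ[u]` attached to a solution of the Mazorchuk–Turowska
equation. -/
noncomputable def polyRep {α₁ α₂ : ℂ} {p₁ p₂ : ℂ[X]} (h : MTE α₁ α₂ p₁ p₂) :
    ATilde α₁ α₂ p₁ p₂ →ₐ[ℂ] Module.End ℂ ℂ[X] :=
  RingQuot.liftAlgHom ℂ ⟨FreeAlgebra.lift ℂ (polyRepGen α₁ α₂ p₁ p₂),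
    fun _ _ hab => polyRepGen_rel h hab⟩

theorem polyRep_H {α₁ α₂ : ℂ} {p₁ p₂ : ℂ[X]} (h : MTE α₁ α₂ p₁ p₂) :
    polyRep h (H α₁ α₂ p₁ p₂) = Algebra.lmul ℂ ℂ[X] X :=
  (RingQuot.liftAlgHom_mkAlgHom_apply ℂ _ _ _).trans (FreeAlgebra.lift_ι_apply _ _)

theorem transcendental_of_MTE {α₁ α₂ : ℂ} {p₁ p₂ : ℂ[X]} (h : MTE α₁ α₂ p₁ p₂) :
    Transcendental ℂ (H α₁ α₂ p₁ p₂) := by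
  rintro ⟨f, hf, hfH⟩
  apply hf
  -- The vector 1 recovers f, because f(H) acts as multiplication by f.
  have h0 := congrArg (fun a => polyRep h a 1) hfH
  rw [← aeval_algHom_apply, polyRep_H, aeval_algHom_apply, aeval_X_left_apply] at h0
  simpa using h0

end KleinianFiberProduct

theorem mainTheorem10 (α₁ α₂ : ℂ) (p₁ p₂ : Polynomial ℂ) (hp₁ : p₁ ≠ 0) (hp₂ : p₂ ≠ 0) :
    List.TFAE
      [Nontrivial (KleinianFiberProduct.A α₁ α₂ p₁ p₂),
       Transcendental ℂ (KleinianFiberProduct.H α₁ α₂ p₁ p₂),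
       KleinianFiberProduct.MTE α₁ α₂ p₁ p₂] := by
  tfae_have 1 ↔ 2 := KleinianFiberProduct.nontrivial_A_iff.trans
    KleinianFiberProduct.not_isTorsion_one_iff
  tfae_have 2 → 3 := KleinianFiberProduct.MTE_of_transcendental
  tfae_have 3 → 2 := KleinianFiberProduct.transcendental_of_MTE
  tfae_finish
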